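/- Let $d \ge 0$ be an integer. For an integer $N \ge 3$ let $T^d_N$ be the $d$-dimensional discrete torus, i.e. the Cayley graph of the group $(\mathbb{Z}/N\mathbb{Z})^d$ with respect to the generating set $\{\pm e_1,\dots,\pm e_d\}$, where $e_i$ has $1$ in the $i$-th coordinate and $0$ elsewhere. List the eigenvalues of the adjacency matrix of $T^d_N$ with multiplicity in non-increasing order, $\mu_1 \ge \mu_2 \ge \cdots \ge \mu_{N^d}$, and for an eigenvalue $\mu$ let $m_{T^d_N}(\mu)$ denote its multiplicity, i.e. the dimension of the corresponding eigenspace. There exist constants $c_d$ with $0 < c_d \le \tfrac12$ and $C_d$, depending only on $d$, such that for every $N \ge 3$ and every integer $k$ with $1 \le k < c_d N^d$ or $(1-c_d)N^d < k \le N^d$, one has $m_{T^d_N}(\mu_k) \le C_d$. -/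

import Mathlib

/-- The discrete torus `T^d_N`: the Cayley graph of the group `(ℤ/Nℤ)^d` with respect to the
generating set `{±e_1, …, ±e_d}`, where `e_i` has `1` in coordinate `i` and `0` elsewhere. -/
def discreteTorus (d N : ℕ) : SimpleGraph (Fin d → ZMod N) :=
  SimpleGraph.addCayley
    {s | ∃ i : Fin d, s = Pi.single i (1 : ZMod N) ∨ s = -Pi.single i (1 : ZMod N)}

open scoped Classical in
/-- The adjacency matrix of `T^d_N`, with real entries. -/
noncomputable def torusMatrix (d N : ℕ) :
    Matrix (Fin d → ZMod N) (Fin d → ZMod N) ℝ :=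
  (discreteTorus d N).adjMatrix ℝ

theorem torusMatrix_isHermitian (d N : ℕ) : (torusMatrix d N).IsHermitian :=
  by
  classical
  exact SimpleGraph.isHermitian_adjMatrix ℝ (discreteTorus d N)

theorem card_torus (d N : ℕ) [NeZero N] : Fintype.card (Fin d → ZMod N) = N ^ d := by
  simp [ZMod.card]

/-- The eigenvalues of (the adjacency matrix of) `T^d_N`, listed with multiplicity in
non-increasing order `μ_1 ≥ μ_2 ≥ ⋯ ≥ μ_{N^d}`. The index is zero-based: the value at
`⟨k - 1, _⟩` is `μ_k`. -/
noncomputable def torusEigenvalue (d N : ℕ) [NeZero N] (j : Fin (N ^ d)) : ℝ :=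
  (torusMatrix_isHermitian d N).eigenvalues₀ (Fin.cast (card_torus d N).symm j)

/-- The multiplicity `m_{T^d_N}(μ)`: the dimension of the `μ`-eigenspace of the adjacency
matrix. -/
noncomputable def torusMultiplicity (d N : ℕ) [NeZero N] (μ : ℝ) : ℕ :=
  Module.finrank ℝ (Module.End.eigenspace (Matrix.toLin' (torusMatrix d N)) μ)

/-! The characters of `(ℤ/Nℤ)^d` diagonalise the adjacency matrix, so the eigenvalues are the sums
of `2 cos (2π y_i / N)` over the coordinates of a frequency `y`. Two frequencies with the same
eigenvalue give a rational relation among at most `4d` roots of unity. By Mann's theorem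
(`coeff_eq_zero_of_sum_rootsOfUnity_eq_zero`) such a relation has only zero coefficients once the
roots have distinct `Q`-th powers, where `Q = (4d)!`.

Close to the extreme values `±2d`, every root involved is so close to `±1` that distinct roots do
have distinct `Q`-th powers (`eq_of_pow_eq_of_near_sign`). Each coordinate of one frequency is then,
up to sign, a coordinate of the other, and at most `(2d)^d` frequencies share the eigenvalue
(`card_torusSymbol_eq_le`).

A box of frequencies with all coordinates near `0`, or all near `N/2`, shows that a fixed proportion
of the spectrum lies in these windows (`pow_le_card_near_sign`). -/

/-! ### Rational relations among roots of unity -/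

/-- A rational linear relation among `n`-th roots of unity is preserved by the Galois action
`z ↦ z ^ u`, for `u` coprime to `n`. -/
theorem sum_mul_pow_eq_zero_of_coprime {ι : Type*} (s : Finset ι) (a : ι → ℚ) (z : ι → ℂ)
    {n : ℕ} (hn : 0 < n) (hz : ∀ i ∈ s, z i ^ n = 1) (h : ∑ i ∈ s, (a i : ℂ) * z i = 0)
    {u : ℕ} (hu : u.Coprime n) : ∑ i ∈ s, (a i : ℂ) * z i ^ u = 0 := by
  have hζ := Complex.isPrimitiveRoot_exp n hn.ne'
  set ζ := Complex.exp (2 * Real.pi * Complex.I / n)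
  have hex : ∀ i, ∃ e : ℕ, i ∈ s → ζ ^ e = z i := by
    intro i
    by_cases hi : i ∈ s
    · have : NeZero n := ⟨hn.ne'⟩
      obtain ⟨e, -, he⟩ := hζ.eq_pow_of_pow_eq_one (hz i hi)
      exact ⟨e, fun _ => he⟩
    · exact ⟨0, fun h => absurd h hi⟩
  choose e he using hex
  let F : Polynomial ℚ := ∑ i ∈ s, Polynomial.C (a i) * Polynomial.X ^ e i
  have hF : ∀ w : ℂ, Polynomial.aeval w F = ∑ i ∈ s, (a i : ℂ) * w ^ e i := by
    intro w
    simp [F, map_sum]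
  have h0 : Polynomial.aeval ζ F = 0 := by
    rw [hF, ← h]
    exact Finset.sum_congr rfl fun i hi => by rw [he i hi]
  have hζu := hζ.pow_of_coprime u hu
  -- Both `ζ` and `ζ ^ u` are primitive, so they share the cyclotomic polynomial as minimal
  -- polynomial.
  have hdvd : minpoly ℚ (ζ ^ u) ∣ F := by
    rw [← Polynomial.cyclotomic_eq_minpoly_rat hζu hn,
      Polynomial.cyclotomic_eq_minpoly_rat hζ hn]
    exact minpoly.dvd _ _ h0
  have h1 : Polynomial.aeval (ζ ^ u) F = 0 :=
    Polynomial.aeval_eq_zero_of_dvd_aeval_eq_zero hdvd (minpoly.aeval _ _)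
  rw [hF] at h1
  rw [← h1]
  refine Finset.sum_congr rfl fun i hi => ?_
  rw [← he i hi, ← pow_mul, ← pow_mul, mul_comm u]

theorem geom_sum_eq_ite_of_pow_eq_one {p : ℕ} {v : ℂ} (hv : v ^ p = 1) :
    ∑ j ∈ Finset.range p, v ^ j = if v = 1 then (p : ℂ) else 0 := by
  split_ifs with h
  · simp [h]
  · have := mul_geom_sum v p
    rw [hv, sub_self] at this
    exact (mul_eq_zero.mp this).resolve_left (sub_ne_zero.mpr h)

/-- Fourier inversion on the `p`-th roots of unity. -/
theorem sum_geom_twist_eq {ι : Type*} (s : Finset ι) (b w : ι → ℂ) {p : ℕ} {c : ℂ}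
    (hc : c ^ p = 1) (hc0 : c ≠ 0) (hw : ∀ i ∈ s, w i ^ p = 1) :
    ∑ j ∈ Finset.range p, (c⁻¹) ^ j * ∑ i ∈ s, b i * w i ^ j
      = p * ∑ i ∈ s with w i = c, b i := by
  classical
  simp_rw [Finset.mul_sum]
  rw [Finset.sum_comm, Finset.sum_filter]
  refine Finset.sum_congr rfl fun i hi => ?_
  have h1 : (c⁻¹ * w i) ^ p = 1 := by rw [mul_pow, inv_pow, hc, hw i hi]; simp
  have h2 : ∀ j, c⁻¹ ^ j * (b i * w i ^ j) = b i * (c⁻¹ * w i) ^ j := fun j => by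
    rw [mul_pow]; ring
  simp_rw [h2]
  rw [← Finset.mul_sum, geom_sum_eq_ite_of_pow_eq_one h1]
  have h3 : c⁻¹ * w i = 1 ↔ w i = c := by
    rw [inv_mul_eq_one₀ hc0, eq_comm]
  by_cases h : w i = c
  · simp [h, hc0, mul_comm]
  · simp [h3, h]

/-- **Mann's theorem**, in the form: if `Q` is divisible by all primes `p ≤ k`, then at most `k`
roots of unity whose `Q`-th powers are distinct are linearly independent over `ℚ`. -/
theorem coeff_eq_zero_of_sum_rootsOfUnity_eq_zero {ι : Type*} {k Q : ℕ}
    (hQ : ∀ p : ℕ, p.Prime → p ≤ k → p ∣ Q) (n : ℕ) (hn : 0 < n) :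
    ∀ (s : Finset ι) (a : ι → ℚ) (z : ι → ℂ), s.card ≤ k → (∀ i ∈ s, z i ^ n = 1) →
      (∀ i ∈ s, ∀ j ∈ s, z i ^ Q = z j ^ Q → i = j) → ∑ i ∈ s, (a i : ℂ) * z i = 0 →
      ∀ i ∈ s, a i = 0 := by
  classical
  induction n using Nat.strong_induction_on with
  | _ n ih =>
  intro s a z hcard hz hinj hsum i₀ hi₀
  rcases eq_or_ne n 1 with rfl | hn1
  · have hs : s = {i₀} := by
      refine Finset.eq_singleton_iff_unique_mem.mpr ⟨hi₀, fun j hj => hinj j hj i₀ hi₀ ?_⟩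
      have h1 := hz j hj
      have h2 := hz i₀ hi₀
      rw [pow_one] at h1 h2
      rw [h1, h2]
    have h2 := hz i₀ hi₀
    rw [pow_one] at h2
    rw [hs, Finset.sum_singleton, h2, mul_one] at hsum
    exact_mod_cast hsum
  obtain ⟨p, hp, m, rfl⟩ := Nat.exists_prime_and_dvd hn1
  have hm : 0 < m := Nat.pos_of_mul_pos_left hn
  have hmlt : m < p * m := by
    have := hp.two_le
    nlinarith
  have hp0 : (p : ℂ) ≠ 0 := by exact_mod_cast hp.ne_zero
  have hz0 : ∀ i ∈ s, z i ≠ 0 := by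
    intro i hi h0
    have := hz i hi
    rw [h0, zero_pow hn.ne'] at this
    exact zero_ne_one this
  have hw : ∀ i ∈ s, (z i ^ m) ^ p = 1 := fun i hi => by
    rw [← pow_mul, mul_comm m p]; exact hz i hi
  -- Raising to the power `1 + j * m` is a Galois action which multiplies each `z i` by a power of
  -- the `p`-th root of unity `z i ^ m`. The terms are sorted below by the value of `z i ^ m`.
  have hgal : ∀ j : ℕ, ¬ p ∣ 1 + j * m →
      ∑ i ∈ s, (a i : ℂ) * z i * (z i ^ m) ^ j = 0 := by
    intro j hj
    have hcop : (1 + j * m).Coprime (p * m) := by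
      refine Nat.Coprime.mul_right ?_ ?_
      · exact ((Nat.Prime.coprime_iff_not_dvd hp).mpr hj).symm
      · simp
    rw [← sum_mul_pow_eq_zero_of_coprime s a z hn hz hsum hcop]
    refine Finset.sum_congr rfl fun i _ => ?_
    rw [← pow_mul, pow_add, pow_one, mul_assoc, mul_comm m j]
  set c₁ := z i₀ ^ m with hc₁
  have hc₁p : c₁ ^ p = 1 := hw i₀ hi₀
  have hc₁0 : c₁ ≠ 0 := pow_ne_zero _ (hz0 i₀ hi₀)
  by_cases hpm : p ∣ m
  -- Every twist is admissible here, so by Fourier inversion each class sum vanishes; dividing a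
  -- class by one of its members gives `m`-th roots of unity.
  · have hall : ∀ j : ℕ, ∑ i ∈ s, (a i : ℂ) * z i * (z i ^ m) ^ j = 0 := by
      intro j
      refine hgal j fun hdvd => hp.one_lt.ne' ?_
      have := (Nat.dvd_add_left (hpm.mul_left j)).mp hdvd
      exact Nat.dvd_one.mp this
    have key := sum_geom_twist_eq s (fun i => (a i : ℂ) * z i) (fun i => z i ^ m) hc₁p hc₁0 hw
    simp only [hall, mul_zero, Finset.sum_const_zero] at key
    have key2 := (mul_eq_zero.mp key.symm).resolve_left hp0
    refine ih m hmlt hm (s.filter fun i => z i ^ m = c₁) a (fun i => z i / z i₀)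
      ((Finset.card_filter_le _ _).trans hcard) ?_ ?_ ?_ i₀ (by simp [hi₀, hc₁])
    · intro i hi
      rw [div_pow, (Finset.mem_filter.mp hi).2, div_self hc₁0]
    · intro i hi j hj hij
      refine hinj i (Finset.mem_filter.mp hi).1 j (Finset.mem_filter.mp hj).1 ?_
      simp only [div_pow] at hij
      exact (div_left_inj' (pow_ne_zero _ (hz0 i₀ hi₀))).mp hij
    · simp_rw [← mul_div_assoc]
      rw [← Finset.sum_div, key2, zero_div]
  -- Exactly one twist modulo `p` fails to be Galois. It is also the one that turns every `z i` into
  -- an `m`-th root of unity.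
  · obtain ⟨j₀, hj₀lt, hj₀⟩ : ∃ j₀ < p, p ∣ 1 + j₀ * m := by
      have : Fact p.Prime := ⟨hp⟩
      have hm0 : (m : ZMod p) ≠ 0 := by rwa [Ne, ZMod.natCast_eq_zero_iff]
      refine ⟨(-(m : ZMod p)⁻¹).val, ZMod.val_lt _, ?_⟩
      rw [← ZMod.natCast_eq_zero_iff]
      push_cast
      rw [ZMod.natCast_zmod_val, neg_mul, inv_mul_cancel₀ hm0]
      ring
    have hnot : ∀ j < p, j ≠ j₀ → ¬ p ∣ 1 + j * m := by
      intro j hj hne hdvd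
      apply hne
      have h1 : (1 + j * m) ≡ (1 + j₀ * m) [MOD p] :=
        ((Nat.modEq_zero_iff_dvd).mpr hdvd).trans ((Nat.modEq_zero_iff_dvd).mpr hj₀).symm
      have h2 : j * m ≡ j₀ * m [MOD p] := Nat.ModEq.add_left_cancel' 1 h1
      have h3 : j ≡ j₀ [MOD p] :=
        Nat.ModEq.cancel_right_of_coprime ((Nat.Prime.coprime_iff_not_dvd hp).mpr hpm) h2
      exact Nat.ModEq.eq_of_lt_of_lt h3 hj hj₀lt
    -- the twisted class sums do not depend on the class
    have hB : ∀ c : ℂ, c ^ p = 1 →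
        p * ∑ i ∈ s with z i ^ m = c, (a i : ℂ) * z i ^ (1 + j₀ * m)
          = ∑ i ∈ s, (a i : ℂ) * z i * (z i ^ m) ^ j₀ := by
      intro c hc
      have hc0 : c ≠ 0 := by
        rintro rfl
        rw [zero_pow hp.ne_zero] at hc
        exact zero_ne_one hc
      have key := sum_geom_twist_eq s (fun i => (a i : ℂ) * z i) (fun i => z i ^ m) hc hc0 hw
      rw [Finset.sum_eq_single_of_mem j₀ (Finset.mem_range.mpr hj₀lt)
        (fun j hj hne => by rw [hgal j (hnot j (Finset.mem_range.mp hj) hne), mul_zero])] at key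
      have hfil : ∑ i ∈ s with z i ^ m = c, (a i : ℂ) * z i ^ (1 + j₀ * m)
          = c ^ j₀ * ∑ i ∈ s with z i ^ m = c, (a i : ℂ) * z i := by
        rw [Finset.mul_sum]
        refine Finset.sum_congr rfl fun i hi => ?_
        rw [← (Finset.mem_filter.mp hi).2, ← pow_mul, pow_add, pow_one, mul_comm m j₀]
        ring
      rw [hfil, mul_left_comm, ← key, ← mul_assoc, ← mul_pow, mul_inv_cancel₀ hc0, one_pow,
        one_mul]
    -- The class of `c₁` is compared with a second one. If `p ≤ k` any other class will do, since `p
    -- ∣ Q`; if `p > k` there are too few terms to fill all `p` classes, and an empty one is taken.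
    obtain ⟨c₂, hc₂p, hc₂ne, hc₂⟩ : ∃ c₂ : ℂ, c₂ ^ p = 1 ∧ c₂ ≠ c₁ ∧
        (p ∣ Q ∨ ∀ i ∈ s, z i ^ m ≠ c₂) := by
      have hprim := Complex.isPrimitiveRoot_exp p hp.ne_zero
      by_cases hpk : p ≤ k
      · refine ⟨c₁ * Complex.exp (2 * Real.pi * Complex.I / p), ?_, ?_, Or.inl (hQ p hp hpk)⟩
        · rw [mul_pow, hc₁p, hprim.pow_eq_one, one_mul]
        · intro h
          exact hprim.ne_one hp.one_lt (mul_left_cancel₀ hc₁0 (h.trans (mul_one c₁).symm))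
      · have hlt : (s.image fun i => z i ^ m).card < (Polynomial.nthRootsFinset p (1 : ℂ)).card := by
          rw [hprim.card_nthRootsFinset]
          exact (Finset.card_image_le.trans hcard).trans_lt (not_le.mp hpk)
        obtain ⟨c, hc, hcn⟩ := Finset.exists_mem_notMem_of_card_lt_card hlt
        have hcn' : ∀ i ∈ s, z i ^ m ≠ c := fun i hi h =>
          hcn (Finset.mem_image.mpr ⟨i, hi, h⟩)
        exact ⟨c, (Polynomial.mem_nthRootsFinset hp.pos 1).mp hc,
          fun h => hcn' i₀ hi₀ h.symm, Or.inr hcn'⟩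
    have hBB := mul_left_cancel₀ hp0 ((hB c₁ hc₁p).trans (hB c₂ hc₂p).symm)
    have hres := ih m hmlt hm (s.filter fun i => z i ^ m = c₁ ∨ z i ^ m = c₂)
      (fun i => if z i ^ m = c₁ then a i else - a i) (fun i => z i ^ (1 + j₀ * m))
      ((Finset.card_filter_le _ _).trans hcard) ?_ ?_ ?_ i₀ (by simp [hi₀, hc₁])
    · simpa [hc₁] using hres
    · intro i hi
      obtain ⟨t, ht⟩ := hj₀
      rw [← pow_mul, ht, mul_right_comm, pow_mul, hz i (Finset.mem_filter.mp hi).1, one_pow]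
    · intro i hi j hj hij
      obtain ⟨his, hic⟩ := Finset.mem_filter.mp hi
      obtain ⟨hjs, hjc⟩ := Finset.mem_filter.mp hj
      refine hinj i his j hjs ?_
      have hexp : ∀ x : ℂ, (x ^ (1 + j₀ * m)) ^ Q = x ^ Q * (x ^ m) ^ (j₀ * Q) := by
        intro x
        rw [← pow_mul, ← pow_mul, ← pow_add]
        ring_nf
      simp only [hexp] at hij
      -- The twist changes `Q`-th powers by a common factor: it is `1` if `p ∣ Q`, and otherwise
      -- only the class of `c₁` is present.
      have hsame : (z i ^ m) ^ (j₀ * Q) = (z j ^ m) ^ (j₀ * Q) := by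
        rcases hc₂ with ⟨t, rfl⟩ | hemp
        · have : ∀ x ∈ s, (z x ^ m) ^ (j₀ * (p * t)) = 1 := by
            intro x hx
            rw [mul_left_comm, pow_mul, hw x hx, one_pow]
          rw [this i his, this j hjs]
        · rw [hic.resolve_right (hemp i his), hjc.resolve_right (hemp j hjs)]
      rw [hsame] at hij
      exact mul_right_cancel₀ (pow_ne_zero _ (pow_ne_zero _ (hz0 j hjs))) hij
    · rw [Finset.filter_or, Finset.sum_union]
      · have e1 : ∑ i ∈ s with z i ^ m = c₁,
            (((if z i ^ m = c₁ then a i else - a i : ℚ)) : ℂ) * z i ^ (1 + j₀ * m)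
            = ∑ i ∈ s with z i ^ m = c₁, (a i : ℂ) * z i ^ (1 + j₀ * m) :=
          Finset.sum_congr rfl fun i hi => by rw [if_pos (Finset.mem_filter.mp hi).2]
        have e2 : ∑ i ∈ s with z i ^ m = c₂,
            (((if z i ^ m = c₁ then a i else - a i : ℚ)) : ℂ) * z i ^ (1 + j₀ * m)
            = - ∑ i ∈ s with z i ^ m = c₂, (a i : ℂ) * z i ^ (1 + j₀ * m) := by
          rw [← Finset.sum_neg_distrib]
          refine Finset.sum_congr rfl fun i hi => ?_
          rw [if_neg (by rw [(Finset.mem_filter.mp hi).2]; exact hc₂ne)]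
          push_cast
          ring
        rw [e1, e2, hBB, add_neg_cancel]
      · rw [Finset.disjoint_filter]
        intro i _ h1 h2
        exact hc₂ne (h2.symm.trans h1)

/-! ### Diagonalisation by characters -/

/-- The eigenvalue of the torus attached to the frequency `y`. -/
noncomputable def torusSymbol (d N : ℕ) [NeZero N] (y : Fin d → ZMod N) : ℝ :=
  ∑ i, 2 * (ZMod.stdAddChar (y i) : ℂ).re

theorem stdAddChar_add_neg {N : ℕ} [NeZero N] (y : ZMod N) :
    (ZMod.stdAddChar y : ℂ) + ZMod.stdAddChar (-y) = ((2 * (ZMod.stdAddChar y : ℂ).re : ℝ) : ℂ) := by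
  rw [ZMod.stdAddChar_apply, ZMod.stdAddChar_apply, AddChar.map_neg_eq_inv,
    Circle.coe_inv_eq_conj, Complex.add_conj]

theorem sum_stdAddChar_smul {N : ℕ} [NeZero N] (y : ZMod N) :
    ∑ x : ZMod N, (ZMod.stdAddChar (x * y) : ℂ) = if y = 0 then (N : ℂ) else 0 := by
  rw [AddChar.sum_mulShift _ (ZMod.isPrimitive_stdAddChar N), ZMod.card]
  split_ifs <;> simp

theorem sum_stdAddChar_dotProduct {d N : ℕ} [NeZero N] (y : Fin d → ZMod N) :
    ∑ x : Fin d → ZMod N, (ZMod.stdAddChar (x ⬝ᵥ y) : ℂ) = if y = 0 then (N : ℂ) ^ d else 0 := by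
  classical
  have h : ∀ x : Fin d → ZMod N,
      (ZMod.stdAddChar (x ⬝ᵥ y) : ℂ) = ∏ i, ZMod.stdAddChar (x i * y i) := by
    intro x
    exact map_prod (ZMod.stdAddChar (N := N)).toMonoidHom
      (fun i => Multiplicative.ofAdd (x i * y i)) Finset.univ
  simp_rw [h]
  rw [← Fintype.prod_sum fun i (t : ZMod N) => (ZMod.stdAddChar (t * y i) : ℂ)]
  simp_rw [sum_stdAddChar_smul]
  split_ifs with hy
  · simp [hy]
  · obtain ⟨i, hi⟩ := Function.ne_iff.mp hy
    exact Finset.prod_eq_zero (Finset.mem_univ i) (if_neg hi)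

/-- The character table of `(ℤ/Nℤ)^d`. -/
noncomputable def characterMatrix (d N : ℕ) [NeZero N] :
    Matrix (Fin d → ZMod N) (Fin d → ZMod N) ℂ :=
  Matrix.of fun x y => ZMod.stdAddChar (x ⬝ᵥ y)

theorem isUnit_characterMatrix (d N : ℕ) [NeZero N] : IsUnit (characterMatrix d N) := by
  have hN : ((N : ℂ) ^ d) ≠ 0 := pow_ne_zero _ (by exact_mod_cast NeZero.ne N)
  have h : (((N : ℂ) ^ d)⁻¹ • Matrix.of fun x y : Fin d → ZMod N =>
      (ZMod.stdAddChar (-(x ⬝ᵥ y)) : ℂ)) * characterMatrix d N = 1 := by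
    ext x y
    rw [Matrix.smul_mul, Matrix.smul_apply, Matrix.mul_apply]
    have h1 : ∀ w : Fin d → ZMod N, (ZMod.stdAddChar (-(x ⬝ᵥ w)) : ℂ) * ZMod.stdAddChar (w ⬝ᵥ y)
        = ZMod.stdAddChar (w ⬝ᵥ (y - x)) := by
      intro w
      rw [← AddChar.map_add_eq_mul, dotProduct_sub, dotProduct_comm x w]
      congr 1
      ring
    simp only [characterMatrix, Matrix.of_apply, h1]
    rw [sum_stdAddChar_dotProduct, Matrix.one_apply, smul_eq_mul]
    by_cases hxy : x = y
    · simp [hxy, inv_mul_cancel₀ hN]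
    · rw [if_neg (sub_ne_zero.mpr (Ne.symm hxy)), if_neg hxy, mul_zero]
  exact IsUnit.of_mul_eq_one_right _ h

theorem discreteTorus_adj_iff {d N : ℕ} (hN : 3 ≤ N) (x y : Fin d → ZMod N) :
    (discreteTorus d N).Adj x y ↔
      ∃ i : Fin d, y = x + Pi.single i 1 ∨ y = x - Pi.single i 1 := by
  have : Fact (1 < N) := ⟨by omega⟩
  rw [discreteTorus, SimpleGraph.addCayley_adj']
  constructor
  · rintro ⟨-, g, ⟨i, rfl | rfl⟩, h | h⟩
    · exact ⟨i, Or.inl h.symm⟩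
    · exact ⟨i, Or.inr (by rw [h]; abel)⟩
    · exact ⟨i, Or.inr (by rw [← h]; abel)⟩
    · exact ⟨i, Or.inl (by rw [h]; abel)⟩
  · rintro ⟨i, rfl | rfl⟩
    · refine ⟨?_, _, ⟨i, Or.inl rfl⟩, Or.inl rfl⟩
      intro h
      have := congrFun h i
      simp at this
    · refine ⟨?_, _, ⟨i, Or.inr rfl⟩, Or.inl (by abel)⟩
      intro h
      have := congrFun h i
      simp [sub_eq_add_neg] at this

theorem sum_ite_discreteTorus_adj {d N : ℕ} [NeZero N] (hN : 3 ≤ N) (x : Fin d → ZMod N)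
    (f : (Fin d → ZMod N) → ℂ) [DecidablePred ((discreteTorus d N).Adj x)] :
    ∑ y, (if (discreteTorus d N).Adj x y then f y else 0)
      = ∑ i : Fin d, (f (x + Pi.single i 1) + f (x - Pi.single i 1)) := by
  classical
  have : Fact (1 < N) := ⟨by omega⟩
  -- This is where `3 ≤ N` enters: it keeps the `2d` neighbours distinct.
  have htwo : (1 : ZMod N) ≠ -1 := by
    intro h
    have h2 : ((2 : ℕ) : ZMod N) = 0 := by
      push_cast
      linear_combination h
    rw [ZMod.natCast_eq_zero_iff] at h2
    exact absurd (Nat.le_of_dvd two_pos h2) (by omega)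
  let g : Fin d × Bool → (Fin d → ZMod N) :=
    fun q => x + Pi.single q.1 (if q.2 then (1 : ZMod N) else -1)
  have hg : Function.Injective g := by
    rintro ⟨i, b⟩ ⟨j, b'⟩ h
    have h1 : (Pi.single i (if b then (1 : ZMod N) else -1) : Fin d → ZMod N)
        = Pi.single j (if b' then (1 : ZMod N) else -1) := add_left_cancel h
    have hij : i = j := by
      by_contra hne
      have h2 := congrFun h1 i
      rw [Pi.single_eq_same, Pi.single_eq_of_ne hne] at h2
      cases b <;> simp at h2
    subst hij
    have h2 := Pi.single_injective i h1
    cases b <;> cases b' <;> simp_all [eq_comm]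
  rw [← Finset.sum_filter]
  have himg : Finset.univ.filter (fun y => (discreteTorus d N).Adj x y)
      = Finset.univ.image g := by
    ext y
    simp only [Finset.mem_filter, Finset.mem_univ, true_and, Finset.mem_image,
      discreteTorus_adj_iff hN, Prod.exists, Bool.exists_bool, g]
    refine exists_congr fun i => ?_
    simp [Pi.single_neg, ← sub_eq_add_neg, or_comm, eq_comm]
  rw [himg, Finset.sum_image hg.injOn, Fintype.sum_prod_type]
  refine Finset.sum_congr rfl fun i _ => ?_
  simp [g, Pi.single_neg, ← sub_eq_add_neg]

theorem torusMatrix_mul_characterMatrix {d N : ℕ} [NeZero N] (hN : 3 ≤ N) :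
    (torusMatrix d N).map (algebraMap ℝ ℂ) * characterMatrix d N
      = characterMatrix d N * Matrix.diagonal fun y => (torusSymbol d N y : ℂ) := by
  classical
  ext x y
  rw [Matrix.mul_diagonal, Matrix.mul_apply]
  have h : ∀ w, (torusMatrix d N).map (algebraMap ℝ ℂ) x w * characterMatrix d N w y
      = if (discreteTorus d N).Adj x w then characterMatrix d N w y else 0 := by
    intro w
    rw [Matrix.map_apply, torusMatrix, SimpleGraph.adjMatrix_apply]
    split_ifs <;> simp
  simp_rw [h]
  rw [sum_ite_discreteTorus_adj hN x fun w => characterMatrix d N w y, torusSymbol]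
  push_cast
  rw [Finset.mul_sum]
  refine Finset.sum_congr rfl fun i _ => ?_
  have h2 := stdAddChar_add_neg (y i)
  push_cast at h2
  rw [← h2]
  simp [characterMatrix, sub_eq_add_neg, add_dotProduct, AddChar.map_add_eq_mul,
    single_dotProduct, neg_dotProduct, mul_add]

/-- The invertible character table makes the matrix similar over `ℂ` to a diagonal one; the identity
descends because `ℝ → ℂ` is injective. -/
theorem charpoly_torusMatrix {d N : ℕ} [NeZero N] (hN : 3 ≤ N) :
    (torusMatrix d N).charpoly
      = ∏ y, (Polynomial.X - Polynomial.C (torusSymbol d N y)) := by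
  obtain ⟨U, hU⟩ := isUnit_characterMatrix d N
  have h := torusMatrix_mul_characterMatrix (d := d) hN
  rw [← hU] at h
  have h1 : (torusMatrix d N).map (algebraMap ℝ ℂ)
      = U.val * (Matrix.diagonal fun y => (torusSymbol d N y : ℂ)) * U⁻¹.val := by
    rw [← h, mul_assoc, Units.mul_inv, mul_one]
  refine Polynomial.map_injective (algebraMap ℝ ℂ) (algebraMap ℝ ℂ).injective ?_
  rw [← Matrix.charpoly_map, h1, Matrix.coe_units_inv,
    Matrix.charpoly_units_conj, Matrix.charpoly_diagonal,
    Polynomial.map_prod]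
  simp

theorem roots_charpoly_torusMatrix {d N : ℕ} [NeZero N] (hN : 3 ≤ N) :
    (torusMatrix d N).charpoly.roots = Finset.univ.val.map (torusSymbol d N) := by
  rw [charpoly_torusMatrix hN, ← Polynomial.roots_multiset_prod_X_sub_C
    (Finset.univ.val.map (torusSymbol d N)), Multiset.map_map]
  rfl

theorem torusMultiplicity_le_card {d N : ℕ} [NeZero N] (hN : 3 ≤ N) (μ : ℝ) :
    torusMultiplicity d N μ ≤ (Finset.univ.filter fun y => torusSymbol d N y = μ).card := by
  classical
  have h1 : torusMultiplicity d N μ ≤ (torusMatrix d N).charpoly.rootMultiplicity μ := by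
    have := LinearMap.finrank_eigenspace_le (Matrix.toLin' (torusMatrix d N)) μ
    rwa [Matrix.charpoly_toLin'] at this
  refine h1.trans (le_of_eq ?_)
  rw [← Polynomial.count_roots, roots_charpoly_torusMatrix hN, Multiset.count_map]
  simp [Finset.card_def, eq_comm]

theorem map_torusEigenvalue {d N : ℕ} [NeZero N] (hN : 3 ≤ N) :
    (Finset.univ : Finset (Fin (N ^ d))).val.map (torusEigenvalue d N)
      = Finset.univ.val.map (torusSymbol d N) := by
  rw [← roots_charpoly_torusMatrix hN,
    (torusMatrix_isHermitian d N).roots_charpoly_eq_eigenvalues₀]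
  have h : torusEigenvalue d N = (torusMatrix_isHermitian d N).eigenvalues₀ ∘
    (finCongr (card_torus d N).symm) := rfl
  rw [h, ← Multiset.map_map, Multiset.map_univ_val_equiv]
  rfl

theorem card_filter_torusEigenvalue {d N : ℕ} [NeZero N] (hN : 3 ≤ N) (P : ℝ → Prop)
    [DecidablePred P] :
    (Finset.univ.filter fun j => P (torusEigenvalue d N j)).card
      = (Finset.univ.filter fun y => P (torusSymbol d N y)).card := by
  have h := congrArg (Multiset.countP P) (map_torusEigenvalue (d := d) hN)
  rwa [Multiset.countP_map, Multiset.countP_map] at h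

theorem torusEigenvalue_antitone (d N : ℕ) [NeZero N] : Antitone (torusEigenvalue d N) :=
  fun _ _ h => (torusMatrix_isHermitian d N).eigenvalues₀_antitone h

/-! ### Rigidity of eigenvalues near the ends of the spectrum -/

/-- A `Q`-th root of unity `v ≠ 1` satisfies `∑ (1 - v ^ j) = Q` over `j < Q`, while each term has
norm at most `Q * ‖v - 1‖`; so `v = z / w` cannot be too close to `1`. -/
theorem eq_of_pow_eq_of_norm_sub_lt {Q : ℕ} (hQ : 0 < Q) {z w : ℂ} (hz : ‖z‖ = 1) (hw : ‖w‖ = 1)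
    (hzw : z ^ Q = w ^ Q) (hlt : Q * ‖z - w‖ < 1) : z = w := by
  have hw0 : w ≠ 0 := by
    rintro rfl
    simp at hw
  by_contra hne
  set v := z / w with hv
  have hv1 : ‖v‖ = 1 := by rw [hv, norm_div, hz, hw, div_one]
  have hvQ : v ^ Q = 1 := by rw [hv, div_pow, hzw, div_self (pow_ne_zero _ hw0)]
  have hvne : v ≠ 1 := fun h => hne ((div_eq_one_iff_eq hw0).mp h)
  have hnorm : ‖v - 1‖ = ‖z - w‖ := by
    have : v - 1 = (z - w) / w := by rw [hv, sub_div, div_self hw0]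
    rw [this, norm_div, hw, div_one]
  have hpow : ∀ j : ℕ, ‖1 - v ^ j‖ ≤ j * ‖v - 1‖ := by
    intro j
    induction j with
    | zero => simp
    | succ j ih =>
      have : 1 - v ^ (j + 1) = (1 - v ^ j) + v ^ j * (1 - v) := by ring
      rw [this]
      refine (norm_add_le _ _).trans ?_
      rw [norm_mul, norm_pow, hv1, one_pow, one_mul, norm_sub_rev 1 v]
      push_cast
      linarith
  have hsum : ∑ j ∈ Finset.range Q, (1 - v ^ j) = Q := by
    rw [Finset.sum_sub_distrib, geom_sum_eq_ite_of_pow_eq_one hvQ, if_neg hvne]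
    simp
  have hle : (Q : ℝ) ≤ Q * (Q * ‖v - 1‖) := by
    calc (Q : ℝ) = ‖∑ j ∈ Finset.range Q, (1 - v ^ j)‖ := by rw [hsum]; simp
      _ ≤ ∑ j ∈ Finset.range Q, ‖1 - v ^ j‖ := norm_sum_le _ _
      _ ≤ ∑ _j ∈ Finset.range Q, (Q * ‖v - 1‖) := by
        refine Finset.sum_le_sum fun j hj => (hpow j).trans ?_
        have : (j : ℝ) ≤ Q := by exact_mod_cast (Finset.mem_range.mp hj).le
        gcongr
      _ = Q * (Q * ‖v - 1‖) := by simp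
  have hQ' : (0 : ℝ) < Q := by exact_mod_cast hQ
  rw [hnorm] at hle
  nlinarith

/-- Two points of the unit circle close to the same `σ = ±1` are determined by their
`Q`-th powers. -/
theorem eq_of_pow_eq_of_near_sign {Q : ℕ} (hQ : 0 < Q) {σ : ℝ} (hσ : σ = 1 ∨ σ = -1)
    {z w : ℂ} (hz : ‖z‖ = 1) (hw : ‖w‖ = 1) (hzσ : 1 - 1 / (8 * (Q : ℝ) ^ 2) < σ * z.re)
    (hwσ : 1 - 1 / (8 * (Q : ℝ) ^ 2) < σ * w.re) (hzw : z ^ Q = w ^ Q) : z = w := by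
  have hQ' : (0 : ℝ) < Q := by exact_mod_cast hQ
  have key : ∀ v : ℂ, ‖v‖ = 1 → 1 - 1 / (8 * (Q : ℝ) ^ 2) < σ * v.re →
      ‖v - σ‖ < 1 / (2 * Q) := by
    intro v hv hvσ
    refine lt_of_pow_lt_pow_left₀ 2 (by positivity) ?_
    have h1 : ‖v - σ‖ ^ 2 = 2 - 2 * (σ * v.re) := by
      have h2 : v.re * v.re + v.im * v.im = 1 := by
        rw [← Complex.normSq_apply, Complex.normSq_eq_norm_sq, hv, one_pow]
      rw [← Complex.normSq_eq_norm_sq, Complex.normSq_apply]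
      simp only [Complex.sub_re, Complex.ofReal_re, Complex.sub_im, Complex.ofReal_im, sub_zero]
      rcases hσ with rfl | rfl <;> linear_combination h2
    have h3 : (1 / (2 * (Q : ℝ))) ^ 2 = 2 * (1 / (8 * (Q : ℝ) ^ 2)) := by
      field_simp
      norm_num
    rw [h1, h3]
    linarith
  refine eq_of_pow_eq_of_norm_sub_lt hQ hz hw hzw ?_
  have h1 : ‖z - w‖ < 1 / (2 * Q) + 1 / (2 * Q) := by
    have h2 : z - w = (z - σ) - (w - σ) := by ring
    rw [h2]
    exact (norm_sub_le _ _).trans_lt (add_lt_add (key z hz hzσ) (key w hw hwσ))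
  have h2 : (Q : ℝ) * (1 / (2 * Q) + 1 / (2 * Q)) = 1 := by
    field_simp
    norm_num
  calc (Q : ℝ) * ‖z - w‖ < Q * (1 / (2 * Q) + 1 / (2 * Q)) := by gcongr
    _ = 1 := h2

theorem norm_stdAddChar {N : ℕ} [NeZero N] (t : ZMod N) : ‖(ZMod.stdAddChar t : ℂ)‖ = 1 := by
  rw [ZMod.stdAddChar_apply]
  exact Circle.norm_coe _

theorem stdAddChar_neg_re {N : ℕ} [NeZero N] (t : ZMod N) :
    (ZMod.stdAddChar (-t) : ℂ).re = (ZMod.stdAddChar t : ℂ).re := by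
  rw [ZMod.stdAddChar_apply, ZMod.stdAddChar_apply, AddChar.map_neg_eq_inv,
    Circle.coe_inv_eq_conj, Complex.conj_re]

/-- The width of the windows at the two ends of the spectrum. -/
noncomputable def windowWidth (d : ℕ) : ℝ := 1 / (8 * (((4 * d).factorial : ℕ) : ℝ) ^ 2)

/-- The deficits `2 - 2 σ Re` of the coordinates are nonnegative and add up to `2d - σ *
torusSymbol`, so each is below `2η`. -/
theorem near_sign_of_torusSymbol {d N : ℕ} [NeZero N] {σ η : ℝ} (hσ : σ = 1 ∨ σ = -1)
    {x : Fin d → ZMod N} (hx : 2 * d - 2 * η < σ * torusSymbol d N x) (i : Fin d) :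
    1 - η < σ * (ZMod.stdAddChar (x i) : ℂ).re := by
  have hle : ∀ j, σ * (ZMod.stdAddChar (x j) : ℂ).re ≤ 1 := by
    intro j
    have h1 := abs_le.mp ((Complex.abs_re_le_norm _).trans_eq (norm_stdAddChar (x j)))
    rcases hσ with rfl | rfl <;> linarith
  have h2 : σ * torusSymbol d N x = ∑ j, 2 * (σ * (ZMod.stdAddChar (x j) : ℂ).re) := by
    rw [torusSymbol, Finset.mul_sum]
    exact Finset.sum_congr rfl fun j _ => by ring
  have h3 : ∑ j, (2 - 2 * (σ * (ZMod.stdAddChar (x j) : ℂ).re))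
      = 2 * d - σ * torusSymbol d N x := by
    rw [h2, Finset.sum_sub_distrib]
    simp [mul_comm]
  have h4 := Finset.single_le_sum (f := fun j => 2 - 2 * (σ * (ZMod.stdAddChar (x j) : ℂ).re))
    (fun j _ => by linarith [hle j]) (Finset.mem_univ i)
  simp only [h3] at h4
  linarith

/-- Near the ends of the spectrum, two frequencies with the same eigenvalue have the same
coordinates up to order and signs. -/
theorem exists_eq_or_eq_neg_of_torusSymbol_eq {d N : ℕ} [NeZero N] {σ : ℝ}
    (hσ : σ = 1 ∨ σ = -1) {x y : Fin d → ZMod N} (hxy : torusSymbol d N x = torusSymbol d N y)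
    (hx : 2 * d - 2 * windowWidth d < σ * torusSymbol d N x) (i : Fin d) :
    ∃ j, y i = x j ∨ y i = -x j := by
  classical
  by_contra! hcon
  let s : Finset (ZMod N) :=
    (Finset.univ.image x ∪ Finset.univ.image (-x)) ∪ (Finset.univ.image y ∪ Finset.univ.image (-y))
  have hxs : ∀ j, x j ∈ s := fun j => by simp [s]
  have hxs' : ∀ j, -x j ∈ s := fun j => by simp [s]
  have hys : ∀ j, y j ∈ s := fun j => by simp [s]
  have hys' : ∀ j, -y j ∈ s := fun j => by simp [s]
  -- The coefficient of the root of unity at `t` in the difference of the two eigenvalues, after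
  -- equal roots are collected.
  let a : ZMod N → ℚ := fun t =>
    ∑ j, (((if x j = t then 1 else 0) + (if -x j = t then 1 else 0)) -
      ((if y j = t then 1 else 0) + (if -y j = t then 1 else 0)))
  have hcard : s.card ≤ 4 * d := by
    have him : ∀ f : Fin d → ZMod N, (Finset.univ.image f).card ≤ d := fun f =>
      Finset.card_image_le.trans_eq (by simp)
    have h1 := Finset.card_union_le (Finset.univ.image x) (Finset.univ.image (-x))
    have h2 := Finset.card_union_le (Finset.univ.image y) (Finset.univ.image (-y))
    have h3 := Finset.card_union_le (Finset.univ.image x ∪ Finset.univ.image (-x))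
      (Finset.univ.image y ∪ Finset.univ.image (-y))
    have := him x
    have := him (-x)
    have := him y
    have := him (-y)
    change s.card ≤ _ at h3
    omega
  have hnear : ∀ t ∈ s, 1 - windowWidth d < σ * (ZMod.stdAddChar t : ℂ).re := by
    intro t ht
    have h1 := near_sign_of_torusSymbol hσ hx
    have h2 := near_sign_of_torusSymbol hσ (hxy ▸ hx)
    simp only [s, Finset.mem_union, Finset.mem_image, Finset.mem_univ, true_and,
      Pi.neg_apply] at ht
    rcases ht with (⟨j, rfl⟩ | ⟨j, rfl⟩) | (⟨j, rfl⟩ | ⟨j, rfl⟩)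
    · exact h1 j
    · rw [stdAddChar_neg_re]; exact h1 j
    · exact h2 j
    · rw [stdAddChar_neg_re]; exact h2 j
  have hsum : ∑ t ∈ s, (a t : ℂ) * ZMod.stdAddChar t = 0 := by
    have h1 : ∀ t, (a t : ℂ) * ZMod.stdAddChar t =
        ∑ j, (((if x j = t then (ZMod.stdAddChar t : ℂ) else 0)
            + (if -x j = t then (ZMod.stdAddChar t : ℂ) else 0)) -
          ((if y j = t then (ZMod.stdAddChar t : ℂ) else 0)
            + (if -y j = t then (ZMod.stdAddChar t : ℂ) else 0))) := by
      intro t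
      simp only [a]
      push_cast
      rw [Finset.sum_mul]
      refine Finset.sum_congr rfl fun j _ => ?_
      simp only [sub_mul, add_mul, apply_ite (Rat.cast : ℚ → ℂ), Rat.cast_one, Rat.cast_zero, ite_mul,
        one_mul, zero_mul]
    simp_rw [h1]
    rw [Finset.sum_comm]
    simp only [Finset.sum_sub_distrib, Finset.sum_add_distrib, Finset.sum_ite_eq, hxs, hxs', hys,
      hys', if_true]
    have h2 : ∀ w : Fin d → ZMod N, ∑ j, (ZMod.stdAddChar (w j) : ℂ)
        + ∑ j, (ZMod.stdAddChar (-w j) : ℂ) = (torusSymbol d N w : ℝ) := by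
      intro w
      rw [← Finset.sum_add_distrib, torusSymbol, Complex.ofReal_sum]
      exact Finset.sum_congr rfl fun j _ => stdAddChar_add_neg (w j)
    rw [h2, h2, hxy, sub_self]
  have hN : 0 < N := Nat.pos_of_ne_zero (NeZero.ne N)
  have ha := coeff_eq_zero_of_sum_rootsOfUnity_eq_zero (k := 4 * d) (Q := (4 * d).factorial)
    (fun p hp hle => Nat.dvd_factorial hp.pos hle) N hN s a (fun t => ZMod.stdAddChar t) hcard
    (fun t _ => by rw [← AddChar.map_nsmul_eq_pow]; simp)
    (fun t ht u hu htu => ZMod.injective_stdAddChar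
      (eq_of_pow_eq_of_near_sign (Nat.factorial_pos _) hσ (norm_stdAddChar t) (norm_stdAddChar u)
        (hnear t ht) (hnear u hu) htu))
    hsum (y i) (hys i)
  -- No `±x j` equals `y i`, so nothing can cancel the negative contribution of `y i`.
  have hneg : a (y i) < 0 := by
    simp only [a]
    refine Finset.sum_neg' (fun j _ => ?_) ⟨i, Finset.mem_univ i, ?_⟩
    · rw [if_neg fun h => (hcon j).1 h.symm, if_neg fun h => (hcon j).2 h.symm]
      split_ifs <;> norm_num
    · rw [if_neg fun h => (hcon i).1 h.symm, if_neg fun h => (hcon i).2 h.symm, if_pos rfl]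
      split_ifs <;> norm_num
  exact hneg.ne ha

theorem card_torusSymbol_eq_le {d N : ℕ} [NeZero N] {σ : ℝ} (hσ : σ = 1 ∨ σ = -1) {μ : ℝ}
    (hμ : 2 * d - 2 * windowWidth d < σ * μ) :
    (Finset.univ.filter fun y => torusSymbol d N y = μ).card ≤ (2 * d) ^ d := by
  classical
  rcases (Finset.univ.filter fun y => torusSymbol d N y = μ).eq_empty_or_nonempty with h | ⟨x, hx⟩
  · simp [h]
  · have hx' := (Finset.mem_filter.mp hx).2
    let T : Finset (ZMod N) := Finset.univ.image x ∪ Finset.univ.image (-x)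
    have hT : T.card ≤ 2 * d := by
      have h1 := Finset.card_union_le (Finset.univ.image x) (Finset.univ.image (-x))
      have h2 : (Finset.univ.image x).card ≤ d := Finset.card_image_le.trans_eq (by simp)
      have h3 : (Finset.univ.image (-x)).card ≤ d := Finset.card_image_le.trans_eq (by simp)
      change T.card ≤ _ at h1
      omega
    have hsub : (Finset.univ.filter fun y => torusSymbol d N y = μ)
        ⊆ Fintype.piFinset fun _ : Fin d => T := by
      intro y hy
      rw [Fintype.mem_piFinset]
      intro i
      obtain ⟨j, hj | hj⟩ := exists_eq_or_eq_neg_of_torusSymbol_eq hσ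
        (hx'.trans (Finset.mem_filter.mp hy).2.symm) (hx' ▸ hμ) i
      · simp [T, hj]
      · simp [T, hj]
    refine (Finset.card_le_card hsub).trans ?_
    rw [Fintype.card_piFinset_const]
    exact Nat.pow_le_pow_left hT d

/-! ### Counting eigenvalues near the ends -/

theorem lt_torusEigenvalue_of_lt_card {d N : ℕ} [NeZero N] (hN : 3 ≤ N) (j : Fin (N ^ d)) (t : ℝ)
    (h : (j : ℕ) < (Finset.univ.filter fun y => t < torusSymbol d N y).card) :
    t < torusEigenvalue d N j := by
  by_contra hle
  rw [← card_filter_torusEigenvalue hN fun r => t < r] at h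
  refine absurd h (not_lt.mpr ?_)
  have hsub : (Finset.univ.filter fun i => t < torusEigenvalue d N i) ⊆ Finset.Iio j := by
    intro i hi
    rw [Finset.mem_Iio]
    by_contra hji
    exact hle ((Finset.mem_filter.mp hi).2.trans_le (torusEigenvalue_antitone d N (not_lt.mp hji)))
  exact (Finset.card_le_card hsub).trans_eq (Fin.card_Iio j)

theorem torusEigenvalue_lt_of_lt_card {d N : ℕ} [NeZero N] (hN : 3 ≤ N) (j : Fin (N ^ d)) (t : ℝ)
    (h : N ^ d - 1 - j < (Finset.univ.filter fun y => torusSymbol d N y < t).card) :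
    torusEigenvalue d N j < t := by
  by_contra hle
  rw [← card_filter_torusEigenvalue hN fun r => r < t] at h
  refine absurd h (not_lt.mpr ?_)
  have hsub : (Finset.univ.filter fun i => torusEigenvalue d N i < t) ⊆ Finset.Ioi j := by
    intro i hi
    rw [Finset.mem_Ioi]
    by_contra hji
    exact hle ((torusEigenvalue_antitone d N (not_lt.mp hji)).trans_lt (Finset.mem_filter.mp hi).2)
  exact (Finset.card_le_card hsub).trans_eq (Fin.card_Ioi j)

theorem stdAddChar_natCast_re {N : ℕ} [NeZero N] (n : ℕ) :
    (ZMod.stdAddChar (n : ZMod N) : ℂ).re = Real.cos (2 * Real.pi * n / N) := by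
  have h := ZMod.stdAddChar_coe (N := N) (n : ℤ)
  rw [Int.cast_natCast] at h
  rw [h, ← Complex.exp_ofReal_mul_I_re]
  congr 2
  push_cast
  ring

/-- If `σ * cos` is within `η` of `1` on a run of `m` consecutive frequencies, then at least
`m ^ d` eigenvalues of the torus are within `2 * (d + 1) * η` of `2 * d * σ`. -/
theorem pow_le_card_near_sign {d N : ℕ} [NeZero N] {σ η : ℝ} (hη : 0 < η) (b m : ℕ)
    (hbm : b + m ≤ N) (h : ∀ t < m, 1 - η < σ * Real.cos (2 * Real.pi * (b + t : ℕ) / N)) :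
    m ^ d ≤ (Finset.univ.filter fun y =>
      2 * d - 2 * ((d + 1) * η) < σ * torusSymbol d N y).card := by
  classical
  let T : Finset (ZMod N) := (Finset.range m).image fun t => ((b + t : ℕ) : ZMod N)
  have hT : T.card = m := by
    rw [Finset.card_image_of_injOn, Finset.card_range]
    intro t ht u hu htu
    simp only [Finset.coe_range, Set.mem_Iio] at ht hu
    have := (ZMod.natCast_eq_natCast_iff _ _ _).mp htu
    have := Nat.ModEq.eq_of_lt_of_lt this (by omega) (by omega)
    omega
  have hsub : (Fintype.piFinset fun _ : Fin d => T) ⊆ Finset.univ.filter fun y =>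
      2 * d - 2 * ((d + 1) * η) < σ * torusSymbol d N y := by
    intro y hy
    rw [Fintype.mem_piFinset] at hy
    refine Finset.mem_filter.mpr ⟨Finset.mem_univ _, ?_⟩
    have h1 : ∀ i, 2 - 2 * η ≤ σ * (2 * (ZMod.stdAddChar (y i) : ℂ).re) := by
      intro i
      obtain ⟨t, ht, hti⟩ := Finset.mem_image.mp (hy i)
      have := h t (Finset.mem_range.mp ht)
      rw [← hti, stdAddChar_natCast_re]
      linarith
    have h2 : (d : ℝ) * (2 - 2 * η) ≤ σ * torusSymbol d N y := by
      rw [torusSymbol, Finset.mul_sum]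
      calc (d : ℝ) * (2 - 2 * η) = ∑ _i : Fin d, (2 - 2 * η) := by simp [mul_sub]
        _ ≤ _ := Finset.sum_le_sum fun i _ => h1 i
    -- The factor `d + 1` in place of `d` makes the inequality strict, even for `d = 0`.
    linarith
  calc m ^ d = (Fintype.piFinset fun _ : Fin d => T).card := by
        rw [Fintype.card_piFinset_const, hT]
    _ ≤ _ := Finset.card_le_card hsub

theorem one_sub_lt_cos_of_le {η δ θ : ℝ} (hη : 0 < η) (hη1 : η ≤ 1) (hδ : δ = η / 80)
    (hθ0 : 0 ≤ θ) (hθ : θ ≤ 2 * δ) : 1 - η < Real.cos (2 * Real.pi * θ) := by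
  have h1 := Real.one_sub_sq_div_two_le_cos (x := 2 * Real.pi * θ)
  have h2 : Real.pi ^ 2 ≤ 16 := by nlinarith [Real.pi_le_four, Real.pi_pos]
  have h3 : θ ^ 2 ≤ (2 * δ) ^ 2 := by gcongr
  have h4 : Real.pi ^ 2 * θ ^ 2 ≤ 16 * (2 * δ) ^ 2 := by gcongr
  have h5 : 16 * (2 * δ) ^ 2 ≤ η / 100 := by
    rw [hδ]
    nlinarith
  nlinarith

theorem windowWidth_pos (d : ℕ) : 0 < windowWidth d := by
  have : (0 : ℝ) < ((4 * d).factorial : ℕ) := by exact_mod_cast Nat.factorial_pos _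
  rw [windowWidth]
  positivity

theorem windowWidth_le_one (d : ℕ) : windowWidth d ≤ 1 := by
  have : (1 : ℝ) ≤ ((4 * d).factorial : ℕ) := by exact_mod_cast Nat.factorial_pos _
  rw [windowWidth, div_le_one (by positivity)]
  nlinarith

theorem corollary5p5 (d : ℕ) :
    ∃ c : ℝ, 0 < c ∧ c ≤ 1 / 2 ∧ ∃ C : ℕ,
      ∀ (N : ℕ) [NeZero N], 3 ≤ N →
        ∀ (k : ℕ) (hk₁ : 1 ≤ k) (hk₂ : k ≤ N ^ d),
          ((k : ℝ) < c * (N : ℝ) ^ d ∨ (1 - c) * (N : ℝ) ^ d < (k : ℝ)) →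
            torusMultiplicity d N
              (torusEigenvalue d N ⟨k - 1, Nat.sub_one_lt_of_le hk₁ hk₂⟩) ≤ C := by
  have hw := windowWidth_pos d
  have hd1 : (0 : ℝ) < d + 1 := by positivity
  set η : ℝ := windowWidth d / (d + 1) with hηdef
  have hη : 0 < η := by positivity
  have hη1 : η ≤ 1 := by
    rw [hηdef, div_le_one hd1]
    linarith [windowWidth_le_one d, Nat.cast_nonneg (α := ℝ) d]
  have hηw : (d + 1) * η = windowWidth d := by
    rw [hηdef]
    field_simp
  obtain ⟨δ, hδ⟩ : ∃ δ : ℝ, δ = η / 80 := ⟨_, rfl⟩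
  have hδ0 : 0 < δ := by rw [hδ]; positivity
  have hδ1 : δ ≤ 1 / 80 := by rw [hδ]; linarith
  -- Each window contains the eigenvalues of a box of side `⌈δ * N⌉₊`, whence the proportion `δ ^
  -- d`. The second summand of the bound is for small `N` at the lower end.
  refine ⟨min (1 / 2) (δ ^ d), by positivity, min_le_left _ _,
    (2 * d) ^ d + ⌈1 / δ⌉₊ ^ d, ?_⟩
  intro N _ hN k hk₁ hk₂ hk
  have hN' : (3 : ℝ) ≤ N := by exact_mod_cast hN
  have hN0 : (0 : ℝ) < N := by linarith
  set j : Fin (N ^ d) := ⟨k - 1, Nat.sub_one_lt_of_le hk₁ hk₂⟩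
  have hj : (j : ℕ) = k - 1 := rfl
  have hlt : ∀ t < ⌈δ * N⌉₊, (t : ℝ) < δ * N := fun t ht => Nat.lt_ceil.mp ht
  have hceil : (⌈δ * N⌉₊ : ℝ) < δ * N + 1 := Nat.ceil_lt_add_one (by positivity)
  have hcN : min (1 / 2) (δ ^ d) * (N : ℝ) ^ d ≤ ((⌈δ * N⌉₊ ^ d : ℕ) : ℝ) := by
    calc min (1 / 2) (δ ^ d) * (N : ℝ) ^ d ≤ δ ^ d * (N : ℝ) ^ d := by
          gcongr
          exact min_le_right _ _
      _ = (δ * N) ^ d := (mul_pow _ _ _).symm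
      _ ≤ (⌈δ * N⌉₊ : ℝ) ^ d := by
          gcongr
          exact Nat.le_ceil _
      _ = _ := by push_cast; rfl
  rcases hk with hk | hk
  · have hcard := pow_le_card_near_sign (d := d) (N := N) (σ := 1) hη 0 ⌈δ * N⌉₊ (by
      have : (⌈δ * N⌉₊ : ℝ) ≤ N := by nlinarith
      rw [zero_add]
      exact_mod_cast this) (by
      intro t ht
      rw [zero_add, one_mul, mul_div_assoc]
      refine one_sub_lt_cos_of_le hη hη1 hδ (by positivity) ?_
      rw [div_le_iff₀ hN0]
      nlinarith [hlt t ht])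
    simp only [one_mul, hηw] at hcard
    have hμ := lt_torusEigenvalue_of_lt_card hN j (2 * d - 2 * windowWidth d) (by
      have h1 : (k : ℝ) < ((⌈δ * N⌉₊ ^ d : ℕ) : ℝ) := hk.trans_le hcN
      have h2 : k < ⌈δ * N⌉₊ ^ d := by exact_mod_cast h1
      omega)
    exact ((torusMultiplicity_le_card hN _).trans (card_torusSymbol_eq_le (Or.inl rfl)
      (by rwa [one_mul]))).trans (Nat.le_add_right _ _)
  · rcases le_total N ⌈1 / δ⌉₊ with hsmall | hlarge
    · refine ((torusMultiplicity_le_card hN _).trans (Finset.card_filter_le _ _)).trans ?_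
      rw [Finset.card_univ, card_torus]
      exact (Nat.pow_le_pow_left hsmall d).trans (Nat.le_add_left _ _)
    -- The run starts up to `1/2` past `N/2`; this bound absorbs that offset into the allowance `2 *
    -- δ` of `one_sub_lt_cos_of_le`.
    · have hδN : 1 ≤ δ * N := by
        have h1 : 1 / δ ≤ N := (Nat.le_ceil _).trans (by exact_mod_cast hlarge)
        rwa [div_le_iff₀ hδ0, mul_comm] at h1
      have hhalf : (N : ℝ) / 2 ≤ ((N + 1) / 2 : ℕ) ∧ (((N + 1) / 2 : ℕ) : ℝ) ≤ (N + 1) / 2 := by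
        constructor
        · have h1 : N ≤ 2 * ((N + 1) / 2) := by omega
          have h2 : (N : ℝ) ≤ 2 * ((N + 1) / 2 : ℕ) := by exact_mod_cast h1
          linarith
        · have h1 : 2 * ((N + 1) / 2) ≤ N + 1 := by omega
          have h2 : 2 * (((N + 1) / 2 : ℕ) : ℝ) ≤ N + 1 := by exact_mod_cast h1
          linarith
      have hcard := pow_le_card_near_sign (d := d) (N := N) (σ := -1) hη ((N + 1) / 2) ⌈δ * N⌉₊ (by
        have : (((N + 1) / 2 : ℕ) : ℝ) + (⌈δ * N⌉₊ : ℝ) ≤ N := by nlinarith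
        exact_mod_cast this) (by
        intro t ht
        have h1 := hlt t ht
        have h2 : 2 * Real.pi * (((N + 1) / 2 + t : ℕ) : ℝ) / N
            = 2 * Real.pi * ((((N + 1) / 2 : ℕ) + t - N / 2) / N) + Real.pi := by
          rw [Nat.cast_add]
          field_simp
          ring
        rw [h2, Real.cos_add_pi, neg_one_mul, neg_neg]
        refine one_sub_lt_cos_of_le hη hη1 hδ (div_nonneg ?_ hN0.le) ?_
        · linarith [hhalf.1, Nat.cast_nonneg (α := ℝ) t]
        · rw [div_le_iff₀ hN0]
          linarith [hhalf.2])
      simp only [hηw] at hcard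
      have hμ := torusEigenvalue_lt_of_lt_card hN j (-(2 * d - 2 * windowWidth d)) (by
        have h1 : ((N ^ d : ℕ) : ℝ) < ((⌈δ * N⌉₊ ^ d : ℕ) : ℝ) + k := by
          have h3 : ((N ^ d : ℕ) : ℝ) = (N : ℝ) ^ d := by push_cast; rfl
          rw [h3]
          linarith
        have h2 : N ^ d < ⌈δ * N⌉₊ ^ d + k := by exact_mod_cast h1
        refine lt_of_lt_of_le ?_ (hcard.trans (Finset.card_le_card ?_))
        · omega
        · intro y hy
          rw [Finset.mem_filter] at hy ⊢
          exact ⟨hy.1, by linarith [hy.2]⟩)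
      exact ((torusMultiplicity_le_card hN _).trans (card_torusSymbol_eq_le (Or.inr rfl)
        (by linarith))).trans (Nat.le_add_right _ _)
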